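/- Let $R$ be a unital associative ring (not necessarily commutative), and let $R^{op}$ be the opposite ring; left $R^{op}$-modules are identified with right $R$-modules. Write $\operatorname{spli} R$ for the supremum of the projective dimensions of all injective left $R$-modules, and $\operatorname{silp} R$ for the supremum of the injective dimensions of all projective left $R$-modules (both suprema may be $\infty$); $\operatorname{spli} R^{op}$ and $\operatorname{silp} R^{op}$ are the corresponding invariants of $R^{op}$, that is, those defined by right $R$-modules. If $\operatorname{spli} R$ and $\operatorname{spli} R^{op}$ are both finite, then $$\operatorname{silp} R = \operatorname{spli} R \qquad\text{and}\qquad \operatorname{silp} R^{op} = \operatorname{spli} R^{op}.$$ -/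

import Mathlib

universe u

open CategoryTheory

/-- `spli R`: the supremum of the projective dimensions of the injective left `R`-modules.
Values lie in `WithBot ℕ∞`: `⊤` means infinite, and the zero module has dimension `⊥`. -/
noncomputable def spli (R : Type u) [Ring R] : WithBot ℕ∞ :=
  ⨆ (I : ModuleCat.{u} R) (_ : Module.Injective R I), projectiveDimension I

/-- `silp R`: the supremum of the injective dimensions of the projective left `R`-modules.
Values lie in `WithBot ℕ∞`: `⊤` means infinite, and the zero module has dimension `⊥`. -/
noncomputable def silp (R : Type u) [Ring R] : WithBot ℕ∞ :=
  ⨆ (P : ModuleCat.{u} R) (_ : Module.Projective R P), injectiveDimension P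

/-! The inequality `spli ≤ silp` is dimension shifting
(`ModuleCat.hasProjectiveDimensionLT_of_injectiveDimension`). For `silp ≤ spli`, suppose injective
left modules have projective dimension at most `n`. Embedding `M` in an injective and applying the
horseshoe lemma `n` times puts the `n`-th syzygy of `M` inside a projective, with cokernel again an
`n`-th syzygy. So it is a cycle of a two-sided acyclic complex of free modules
(`IsStableSyzygy.exists_complex`), and `Ext M P (n + 1)` vanishes as soon as `Hom(-, P)` keeps that
complex exact for `P` projective.

Summing all degrees turns the complex into a single square-zero matrix `a`, exact on row vectors.
The right module `J = CharacterModule P` is injective, and so are its powers. By finiteness of `spli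
Rᵐᵒᵖ` they have finite projective dimension, so tensoring them with the complex preserves exactness.
Exactness for all powers of `J` makes exactness for `J` uniform on finite supports
(`isExactSubset_univ`). Character duality converts this into solvability of `k · a = h` on finite
sets (`IsExactSubset.exists_solution_on_finset`), corrections by coboundaries pass to countable
unions (`exists_solution_on_iUnion`), and Zorn's lemma over subcomplexes finishes
(`IsExactSubset.exists_solution`). -/

open MulOpposite

/-! ### Tensoring right modules with a square-zero matrix -/

section RightMap

variable {R : Type u} [Ring R] {X : Type u} (a : X → X →₀ R)

/-- For a right `R`-module `M` and a row-finite matrix `a` over `R`, the additive map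
`(m x)ₓ ↦ (∑ x, m x * a x y)_y` on finitely supported families. -/
noncomputable def rightMap (M : Type u) [AddCommGroup M] [Module Rᵐᵒᵖ M] :
    (X →₀ M) →+ (X →₀ M) :=
  Finsupp.liftAddHom fun x =>
    { toFun := fun μ => (a x).mapRange (fun r => op r • μ) (by simp)
      map_zero' := by ext; simp
      map_add' := fun _ _ => by ext; simp }

variable {M N : Type u} [AddCommGroup M] [Module Rᵐᵒᵖ M] [AddCommGroup N] [Module Rᵐᵒᵖ N]

lemma rightMap_single (x : X) (μ : M) :
    rightMap a M (Finsupp.single x μ) = (a x).mapRange (fun r => op r • μ) (by simp) := by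
  change (Finsupp.single x μ).sum _ = _
  exact Finsupp.sum_single_index (map_zero _)

lemma rightMap_apply (m : X →₀ M) (y : X) :
    rightMap a M m y = m.sum fun x μ => op (a x y) • μ := by
  simp [rightMap, Finsupp.liftAddHom_apply, Finsupp.sum_apply]

lemma mapRange_rightMap (f : M →ₗ[Rᵐᵒᵖ] N) (m : X →₀ M) :
    Finsupp.mapRange f f.map_zero (rightMap a M m) =
      rightMap a N (Finsupp.mapRange f f.map_zero m) := by
  induction m using Finsupp.induction_linear with
  | zero => simp
  | add m₁ m₂ h₁ h₂ =>
    rw [map_add, Finsupp.mapRange_add (by simp), h₁, h₂, Finsupp.mapRange_add (by simp), map_add]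
  | single x μ =>
    rw [Finsupp.mapRange_single, rightMap_single, rightMap_single]
    ext y
    simp

lemma rightMap_mapRange_smul (f : X →₀ R) (μ : M) :
    rightMap a M (f.mapRange (fun r => op r • μ) (by simp)) =
      (Finsupp.linearCombination R a f).mapRange (fun r => op r • μ) (by simp) := by
  induction f using Finsupp.induction_linear with
  | zero => simp
  | add f₁ f₂ h₁ h₂ =>
    rw [map_add, Finsupp.mapRange_add (fun _ _ => by simp [add_smul]), map_add, h₁, h₂,
      Finsupp.mapRange_add (fun _ _ => by simp [add_smul])]
  | single x r =>
    rw [Finsupp.mapRange_single, rightMap_single]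
    ext y
    simp [mul_smul]

lemma rightMap_rightMap (ha : ∀ x, Finsupp.linearCombination R a (a x) = 0) (m : X →₀ M) :
    rightMap a M (rightMap a M m) = 0 := by
  induction m using Finsupp.induction_linear with
  | zero => simp
  | add m₁ m₂ h₁ h₂ => rw [map_add, map_add, h₁, h₂, add_zero]
  | single x μ =>
    rw [rightMap_single, rightMap_mapRange_smul, ha]
    simp

variable {a} in
lemma exists_of_rightMap_apply_ne_zero {m : X →₀ M} {y : X} (h : rightMap a M m y ≠ 0) :
    ∃ x ∈ m.support, a x y ≠ 0 := by
  by_contra! hc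
  refine h ?_
  rw [rightMap_apply]
  exact Finset.sum_eq_zero fun x hx => by simp [hc x hx]

variable (M) in
/-- The complex obtained by tensoring the right module `M` with the matrix `a` is exact. -/
def TensorExact : Prop :=
  ∀ m : X →₀ M, rightMap a M m = 0 → ∃ g, rightMap a M g = m

variable {a}

lemma tensorExact_self
    (hex : ∀ f : X →₀ R, Finsupp.linearCombination R a f = 0 →
      ∃ g, Finsupp.linearCombination R a g = f) : TensorExact a Rᵐᵒᵖ := by
  intro m hm
  have key : ∀ f : X →₀ R, rightMap a Rᵐᵒᵖ (f.mapRange op rfl) =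
      (Finsupp.linearCombination R a f).mapRange op rfl := by
    intro f
    simpa using rightMap_mapRange_smul a f (1 : Rᵐᵒᵖ)
  have hm' : m = (m.mapRange unop rfl).mapRange op rfl := by ext; simp
  rw [hm', key] at hm
  obtain ⟨g, hg⟩ := hex (m.mapRange unop rfl) (by
    ext y
    simpa using DFunLike.congr_fun hm y)
  exact ⟨g.mapRange op rfl, by rw [key, hg, ← hm']⟩

/-- Lift each coordinate separately; only finitely many coordinates of `m` are nonzero, so the lifts
can be summed. -/
lemma TensorExact.finsupp (hM : TensorExact a M) (A : Type u) : TensorExact a (A →₀ M) := by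
  classical
  intro m hm
  have h1 : ∀ i : A, ∃ g : X →₀ M, rightMap a M g =
      Finsupp.mapRange (Finsupp.lapply (R := Rᵐᵒᵖ) i) (map_zero _) m := fun i =>
    hM _ (by rw [← mapRange_rightMap, hm]; simp)
  choose g hg using h1
  let s : Finset A := m.support.biUnion fun x => (m x).support
  refine ⟨∑ i ∈ s, Finsupp.mapRange (Finsupp.lsingle (R := Rᵐᵒᵖ) i) (map_zero _) (g i), ?_⟩
  simp only [map_sum, ← mapRange_rightMap, hg]
  ext x i
  simp only [Finsupp.finsetSum_apply, Finsupp.mapRange_apply, Finsupp.lsingle_apply,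
    Finsupp.lapply_apply, Finsupp.single_apply]
  rw [Finset.sum_ite_eq' s i]
  split_ifs with hi
  · rfl
  · by_contra hne
    refine hi (Finset.mem_biUnion.2 ⟨x, ?_, ?_⟩)
    · rw [Finsupp.mem_support_iff]
      rintro h0
      simp [h0] at hne
    · exact Finsupp.mem_support_iff.2 (Ne.symm hne)

lemma TensorExact.of_retract (hM : TensorExact a M) (i : N →ₗ[Rᵐᵒᵖ] M) (r : M →ₗ[Rᵐᵒᵖ] N)
    (h : ∀ n, r (i n) = n) : TensorExact a N := by
  intro m hm
  obtain ⟨g, hg⟩ := hM (m.mapRange i i.map_zero) (by rw [← mapRange_rightMap, hm]; simp)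
  refine ⟨g.mapRange r r.map_zero, ?_⟩
  rw [← mapRange_rightMap, hg]
  ext x
  simp [h]

/-- This is the long exact homology sequence. Since the complex has the same matrix in every degree,
no index shift appears. -/
lemma TensorExact.of_exact {K : Type u} [AddCommGroup K] [Module Rᵐᵒᵖ K]
    (ha : ∀ x, Finsupp.linearCombination R a (a x) = 0)
    (hK : TensorExact a K) (hM : TensorExact a M) (f : K →ₗ[Rᵐᵒᵖ] M) (g : M →ₗ[Rᵐᵒᵖ] N)
    (hf : Function.Injective f) (hfg : Function.Exact f g) (hg : Function.Surjective g) :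
    TensorExact a N := by
  intro m hm
  obtain ⟨m', rfl⟩ := Finsupp.mapRange_surjective g g.map_zero hg m
  rw [← mapRange_rightMap] at hm
  have h1 : ∃ k : X →₀ K, k.mapRange f f.map_zero = rightMap a M m' := by
    have h2 : ∀ x, ∃ k, f k = rightMap a M m' x := fun x =>
      (hfg _).1 (by simpa using DFunLike.congr_fun hm x)
    choose k hk using h2
    refine ⟨Finsupp.onFinset (rightMap a M m').support k fun x hx => ?_, ?_⟩
    · rw [Finsupp.mem_support_iff, ← hk]
      intro h0
      exact hx (hf (by rw [h0, map_zero]))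
    · ext x
      simp [hk]
  obtain ⟨k, hk⟩ := h1
  obtain ⟨l, hl⟩ := hK k (by
    apply Finsupp.mapRange_injective f f.map_zero hf
    rw [mapRange_rightMap, hk, rightMap_rightMap a ha]
    simp)
  obtain ⟨e, he⟩ := hM (m' - l.mapRange f f.map_zero) (by
    rw [map_sub, ← mapRange_rightMap, hl, hk, sub_self])
  refine ⟨e.mapRange g g.map_zero, ?_⟩
  rw [← mapRange_rightMap, he]
  ext x
  simp [hfg.apply_apply_eq_zero]

lemma TensorExact.of_hasProjectiveDimensionLT
    (ha : ∀ x, Finsupp.linearCombination R a (a x) = 0) (h : TensorExact a Rᵐᵒᵖ) (n : ℕ)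
    (M : ModuleCat.{u} Rᵐᵒᵖ) [HasProjectiveDimensionLT M (n + 1)] : TensorExact a M := by
  induction n generalizing M with
  | zero =>
    have : Module.Projective Rᵐᵒᵖ M := by
      rw [IsProjective.iff_projective]
      exact projective_iff_hasProjectiveDimensionLT_one.2 inferInstance
    obtain ⟨s, hs⟩ := Module.projective_def'.1 this
    exact (h.finsupp M).of_retract s (Finsupp.linearCombination Rᵐᵒᵖ id)
      fun n => LinearMap.congr_fun hs n
  | succ n ih =>
    let g : (M →₀ Rᵐᵒᵖ) →ₗ[Rᵐᵒᵖ] M := Finsupp.linearCombination Rᵐᵒᵖ id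
    have hg : Function.Surjective g := Finsupp.linearCombination_id_surjective Rᵐᵒᵖ M
    have hS := LinearMap.shortExact_shortComplexKer hg
    have : Projective (ModuleCat.of Rᵐᵒᵖ (M →₀ Rᵐᵒᵖ)) :=
      ModuleCat.projective_of_categoryTheory_projective _
    have hK := (hS.hasProjectiveDimensionLT_X₃_iff n this).1 ‹_›
    have hK' := ih (ModuleCat.of Rᵐᵒᵖ (LinearMap.ker g))
    exact TensorExact.of_exact ha hK' (h.finsupp M) (LinearMap.ker g).subtype g
      (Submodule.injective_subtype _) (LinearMap.exact_subtype_ker_map g) hg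

end RightMap

/-! ### Character modules of projectives are injective -/

section CharacterModule

variable {R : Type u} [Ring R] {P : Type u} [AddCommGroup P] [Module R P]

/-- The character module of a left module over a noncommutative ring is a right module. -/
noncomputable instance CharacterModule.instModuleMulOpposite : Module Rᵐᵒᵖ (CharacterModule P) where
  smul r c := AddMonoidHom.comp c (DistribSMul.toAddMonoidHom P r.unop)
  one_smul c := CharacterModule.ext _ fun p => congrArg c (one_smul R p)
  mul_smul r s c := CharacterModule.ext _ fun p => congrArg c (mul_smul s.unop r.unop p)
  smul_zero _ := CharacterModule.ext _ fun _ => rfl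
  smul_add _ _ _ := CharacterModule.ext _ fun _ => rfl
  add_smul r s c := CharacterModule.ext _ fun p =>
    (congrArg c (add_smul r.unop s.unop p)).trans (map_add c _ _)
  zero_smul c := CharacterModule.ext _ fun p => (congrArg c (zero_smul R p)).trans (map_zero c)

lemma CharacterModule.mulOpposite_smul_apply (r : Rᵐᵒᵖ) (c : CharacterModule P) (p : P) :
    (r • c) p = c (r.unop • p) := rfl

instance CharacterModule.injective_of_projective [Module.Projective R P] :
    Module.Injective Rᵐᵒᵖ (CharacterModule P) where
  out A B _ _ _ _ f hf g := by
    obtain ⟨s, hs⟩ := Module.projective_def'.1 ‹Module.Projective R P›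
    -- For each `p` the additive character `x ↦ g x p` extends to `B`, but not linearly in `p`. The
    -- extensions define `φ` on the free cover of `P`, and the section `s` brings it back to `P`.
    have hext : ∀ p : P, ∃ ψ : CharacterModule B, ∀ x : A, ψ (f x) = g x p := fun p => by
      obtain ⟨ψ, hψ⟩ := CharacterModule.dual_surjective_of_injective
        (f.toAddMonoidHom.toIntLinearMap) hf
        (AddMonoidHom.comp (AddMonoidHom.eval p) (g : A →+ CharacterModule P) : A →+ _)
      exact ⟨ψ, fun x => DFunLike.congr_fun hψ x⟩
    choose ψ hψ using hext
    let φ : B →+ (P →₀ R) →+ AddCircle (1 : ℚ) :=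
      { toFun := fun b => Finsupp.liftAddHom fun p =>
          { toFun := fun r => ψ p (op r • b)
            map_zero' := by simp
            map_add' := fun r r' => by simp [add_smul] }
        map_zero' := by ext; simp
        map_add' := fun b b' => by ext; simp }
    have hφ : ∀ b p r, φ b (Finsupp.single p r) = ψ p (op r • b) := fun b p r => by simp [φ]
    have hφs : ∀ (r : R) b q, φ (op r • b) q = φ b (r • q) := fun r b q => by
      induction q using Finsupp.induction_linear with
      | zero => simp
      | add q₁ q₂ h₁ h₂ => simp only [map_add, smul_add, h₁, h₂]
      | single p t => rw [hφ, Finsupp.smul_single, hφ, ← mul_smul]; simp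
    have hφg : ∀ x q, φ (f x) q = g x (Finsupp.linearCombination R id q) := fun x q => by
      induction q using Finsupp.induction_linear with
      | zero => simp
      | add q₁ q₂ h₁ h₂ => simp only [map_add, h₁, h₂]
      | single p t =>
        rw [hφ, ← map_smul, hψ, map_smul, CharacterModule.mulOpposite_smul_apply]
        simp
    refine ⟨{ toFun := fun b => (φ b).comp (s : P →+ P →₀ R)
              map_add' := fun b b' => CharacterModule.ext _ fun p => by
                change φ (b + b') (s p) = φ b (s p) + φ b' (s p)
                simp
              map_smul' := fun r b => CharacterModule.ext _ fun p => by
                change φ (r • b) (s p) = φ b (s (r.unop • p))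
                rw [s.map_smul, ← hφs, op_unop] }, fun x => CharacterModule.ext _ fun p => ?_⟩
    change φ (f x) (s p) = g x p
    rw [hφg]
    exact congrArg (g x) (LinearMap.congr_fun hs p)

end CharacterModule

/-! ### Uniform exactness and solutions on finite sets -/

section Solve

variable {R : Type u} [Ring R] {X : Type u} {a : X → X →₀ R}

/-- A subset `S` of the index set spanning a subcomplex of the complex given by `a`, whose tensor
product with `J` is exact uniformly on finite supports. -/
structure IsExactSubset (a : X → X →₀ R) (J : Type u) [AddCommGroup J] [Module Rᵐᵒᵖ J]
    (S : Set X) : Prop where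
  mem_of_mem : ∀ x ∈ S, ∀ y, a x y ≠ 0 → y ∈ S
  exists_lift : ∀ s : Finset X, (s : Set X) ⊆ S → ∃ t : Finset X, (t : Set X) ⊆ S ∧
    ∀ j : X →₀ J, j.support ⊆ s → rightMap a J j = 0 →
      ∃ g : X →₀ J, g.support ⊆ t ∧ rightMap a J g = j

variable {J : Type u} [AddCommGroup J] [Module Rᵐᵒᵖ J]

lemma isExactSubset_empty : IsExactSubset a J ∅ where
  mem_of_mem := by simp
  exists_lift s hs := by
    refine ⟨∅, by simp, fun j hj _ => ⟨0, by simp, ?_⟩⟩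
    have : s = ∅ := by simpa [Set.subset_empty_iff] using hs
    subst this
    have : j = 0 := by simpa using hj
    simp [this]

/-- Index a power of `J` by the set `L` of all cycles supported in `s`. The tautological family is
one cycle over `L → J`, and the finite support of one preimage bounds the preimages of all cycles in
`L` at once. -/
lemma isExactSubset_univ (h : ∀ L : Type u, TensorExact a (L → J)) :
    IsExactSubset a J Set.univ where
  mem_of_mem := by simp
  exists_lift s _ := by
    classical
    let L := {j : X →₀ J // j.support ⊆ s ∧ rightMap a J j = 0}
    let m : X →₀ (L → J) := Finsupp.onFinset s (fun x l => l.1 x) fun x hx => by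
      obtain ⟨l, hl⟩ := Function.ne_iff.1 hx
      exact l.2.1 (Finsupp.mem_support_iff.2 hl)
    have hm : ∀ l : L, m.mapRange (LinearMap.proj (R := Rᵐᵒᵖ) (φ := fun _ : L => J) l)
        (map_zero _) = l.1 := fun l => by ext; simp [m]
    obtain ⟨g, hg⟩ := h L m (by
      ext x l
      have h1 := mapRange_rightMap a (LinearMap.proj (R := Rᵐᵒᵖ) (φ := fun _ : L => J) l) m
      rw [hm, l.2.2] at h1
      simpa using DFunLike.congr_fun h1 x)
    refine ⟨g.support, by simp, fun j hj hj0 => ?_⟩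
    let l : L := ⟨j, hj, hj0⟩
    refine ⟨g.mapRange (LinearMap.proj (R := Rᵐᵒᵖ) (φ := fun _ : L => J) l) (map_zero _),
      Finsupp.support_mapRange, ?_⟩
    rw [← mapRange_rightMap, hg, hm]

lemma isExactSubset_sUnion {c : Set (Set X)} (hc : DirectedOn (· ⊆ ·) c) (hne : c.Nonempty)
    (h : ∀ S ∈ c, IsExactSubset a J S) : IsExactSubset a J (⋃₀ c) where
  mem_of_mem := by
    rintro x ⟨S, hS, hx⟩ y hy
    exact ⟨S, hS, (h S hS).mem_of_mem x hx y hy⟩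
  exists_lift s hs := by
    obtain ⟨S, hS, hsS⟩ := DirectedOn.exists_mem_subset_of_finite_of_subset_sUnion hne hc s.finite_toSet hs
    obtain ⟨t, ht, h'⟩ := (h S hS).exists_lift s hsS
    exact ⟨t, ht.trans (Set.subset_sUnion_of_mem hS), h'⟩

lemma IsExactSubset.rightMap_apply_eq_zero {S : Set X} (hS : IsExactSubset a J S) {j : X →₀ J}
    (hj : ∀ x ∉ S, j x = 0) {y : X} (hy : y ∉ S) : rightMap a J j y = 0 := by
  by_contra hne
  obtain ⟨x, hx, hxy⟩ := exists_of_rightMap_apply_ne_zero hne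
  refine hy (hS.mem_of_mem x ?_ y hxy)
  by_contra hxS
  exact Finsupp.mem_support_iff.1 hx (hj x hxS)

/-- Uniform exactness passes to the quotient by the subcomplex on `S`: subtract from `j` a chain `g`
in `S` with the same boundary, then lift the resulting cycle. -/
lemma IsExactSubset.exists_lift_mod (ha : ∀ x, Finsupp.linearCombination R a (a x) = 0)
    {S : Set X} (hS : IsExactSubset a J S) (hX : IsExactSubset a J Set.univ) (s : Finset X) :
    ∃ t : Finset X, ∀ j : X →₀ J, j.support ⊆ s → (∀ y ∉ S, rightMap a J j y = 0) →
      ∃ e : X →₀ J, e.support ⊆ t ∧ ∀ x ∉ S, rightMap a J e x = j x := by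
  classical
  obtain ⟨w, hwS, hw⟩ := hS.exists_lift ((s.biUnion fun x => (a x).support).filter (· ∈ S))
    (fun x hx => (Finset.mem_filter.1 hx).2)
  obtain ⟨t, -, ht⟩ := hX.exists_lift (s ∪ w) (Set.subset_univ _)
  refine ⟨t, fun j hj hjS => ?_⟩
  obtain ⟨g, hg, hgj⟩ := hw (rightMap a J j) (fun y hy => by
    have hy' := Finsupp.mem_support_iff.1 hy
    obtain ⟨x, hx, hxy⟩ := exists_of_rightMap_apply_ne_zero hy'
    refine Finset.mem_filter.2 ⟨Finset.mem_biUnion.2 ⟨x, hj hx, Finsupp.mem_support_iff.2 hxy⟩, ?_⟩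
    by_contra hyS
    exact hy' (hjS y hyS)) (rightMap_rightMap a ha j)
  obtain ⟨e, he, hej⟩ := ht (j - g)
    (Finsupp.support_sub.trans (Finset.union_subset_union hj hg)) (by rw [map_sub, hgj, sub_self])
  refine ⟨e, he, fun x hx => ?_⟩
  have : g x = 0 := by
    by_contra hne
    exact hx (hwS (hg (Finsupp.mem_support_iff.2 hne)))
  rw [hej, Finsupp.sub_apply, this, sub_zero]

variable {P : Type u} [AddCommGroup P] [Module R P]

/-- Evaluation of a finitely supported family of characters on a family of elements. -/
noncomputable def characterPairing (h : X → P) :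
    (X →₀ CharacterModule P) →+ AddCircle (1 : ℚ) :=
  Finsupp.liftAddHom fun x => (AddMonoidHom.eval (h x) : (P →+ AddCircle (1 : ℚ)) →+ _)

lemma characterPairing_apply (h : X → P) (j : X →₀ CharacterModule P) :
    characterPairing h j = j.sum fun x c => c (h x) := rfl

lemma characterPairing_single (h : X → P) (x : X) (c : CharacterModule P) :
    characterPairing h (Finsupp.single x c) = c (h x) :=
  Finsupp.sum_single_index rfl

lemma characterPairing_rightMap (h : X → P) (j : X →₀ CharacterModule P) :
    characterPairing h (rightMap a _ j) =
      characterPairing (fun x => Finsupp.linearCombination R h (a x)) j := by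
  induction j using Finsupp.induction_linear with
  | zero => simp
  | add j₁ j₂ h₁ h₂ => simp only [map_add, h₁, h₂]
  | single x c =>
    rw [rightMap_single, characterPairing_single]
    generalize a x = f
    induction f using Finsupp.induction_linear with
    | zero => simp
    | add f₁ f₂ h₁ h₂ =>
      rw [Finsupp.mapRange_add (fun _ _ => by simp [add_smul]), map_add, h₁, h₂, map_add, map_add]
    | single y r =>
      rw [Finsupp.mapRange_single, characterPairing_single]
      simp [CharacterModule.mulOpposite_smul_apply]

/-- By duality: a character of `s → P` killing all coboundaries is a family `j` in `CharacterModule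
P` that is a cycle modulo `S`. Hence it is modulo `S` a boundary of some `e` supported in `t`, and
pairing it with `h` gives zero because `h` is a cocycle on `t`. -/
lemma IsExactSubset.exists_solution_on_finset {S : Set X} {s t : Finset X}
    (ht : ∀ j : X →₀ CharacterModule P, j.support ⊆ s → (∀ y ∉ S, rightMap a _ j y = 0) →
      ∃ e : X →₀ CharacterModule P, e.support ⊆ t ∧ ∀ x ∉ S, rightMap a _ e x = j x)
    (h : X → P) (hS : ∀ x ∈ S, h x = 0)
    (h0 : ∀ x ∈ t, Finsupp.linearCombination R h (a x) = 0) :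
    ∃ k : X → P, (∀ x ∈ S, k x = 0) ∧ ∀ x ∈ s, Finsupp.linearCombination R k (a x) = h x := by
  classical
  let B : AddSubgroup (s → P) :=
    { carrier := {v | ∃ k : X → P, (∀ x ∈ S, k x = 0) ∧
        ∀ x : s, Finsupp.linearCombination R k (a x) = v x}
      zero_mem' := ⟨0, by simp, by simp⟩
      add_mem' := by
        rintro v w ⟨k, hk, hkv⟩ ⟨l, hl, hlw⟩
        refine ⟨k + l, fun x hx => by simp [hk x hx, hl x hx], fun x => ?_⟩
        rw [Pi.add_apply, ← hkv, ← hlw]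
        simp [Finsupp.linearCombination_apply, Finsupp.sum_add]
      neg_mem' := by
        rintro v ⟨k, hk, hkv⟩
        refine ⟨-k, fun x hx => by simp [hk x hx], fun x => ?_⟩
        rw [Pi.neg_apply, ← hkv]
        simp [Finsupp.linearCombination_apply, Finsupp.sum_neg] }
  suffices hB : (fun x : s => h x) ∈ B by
    obtain ⟨k, hk, hkh⟩ := hB
    exact ⟨k, hk, fun x hx => hkh ⟨x, hx⟩⟩
  rw [← QuotientAddGroup.eq_zero_iff]
  refine CharacterModule.eq_zero_of_character_apply fun c => ?_
  let χ : (s → P) →+ AddCircle (1 : ℚ) :=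
    AddMonoidHom.comp (c : (s → P) ⧸ B →+ AddCircle (1 : ℚ)) (QuotientAddGroup.mk' B)
  have hχ : ∀ v ∈ B, χ v = 0 := fun v hv => by
    change c (QuotientAddGroup.mk v) = 0
    rw [(QuotientAddGroup.eq_zero_iff v).2 hv, map_zero]
  let ξ : s → CharacterModule P := fun x => χ.comp (AddMonoidHom.single (fun _ : s => P) x)
  let j : X →₀ CharacterModule P := ∑ x : s, Finsupp.single (x : X) (ξ x)
  have hj : ∀ f : X → P, characterPairing f j = χ fun x : s => f x := fun f => by
    rw [map_sum]
    simp_rw [characterPairing_single]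
    conv_rhs => rw [← Finset.univ_sum_single (fun x : s => f x), map_sum]
    rfl
  have hjs : j.support ⊆ s := by
    refine Finsupp.support_finsetSum.trans (Finset.biUnion_subset.2 fun x _ => ?_)
    exact Finsupp.support_single_subset.trans (by simp)
  -- For `y ∉ S`, the function `Pi.single y p` vanishes on `S`, so its coboundary lies in `B` and is
  -- killed by `χ`.
  obtain ⟨e, het, he⟩ := ht j hjs fun y hy => by
    refine CharacterModule.ext _ fun p => ?_
    have h1 : characterPairing (Pi.single y p) (rightMap a _ j) = rightMap a _ j y p := by
      rw [characterPairing_apply, Finsupp.sum_eq_single y]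
      · simp
      · intro x _ hx
        simp [hx]
      · exact fun _ => rfl
    rw [← h1, characterPairing_rightMap, hj]
    exact hχ _ ⟨Pi.single y p, fun x hx => by
      rw [Pi.single_eq_of_ne]
      rintro rfl
      exact hy hx, fun _ => rfl⟩
  have h2 : characterPairing h j = characterPairing h (rightMap a _ e) := by
    rw [← sub_eq_zero, ← map_sub, characterPairing_apply]
    refine Finset.sum_eq_zero fun x _ => ?_
    by_cases hx : x ∈ S
    · simp [hS x hx]
    · rw [Finsupp.sub_apply, he x hx, sub_self]
      rfl
  change χ (fun x : s => h x) = 0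
  rw [← hj, h2, characterPairing_rightMap, characterPairing_apply]
  exact Finset.sum_eq_zero fun x hx => by simp [h0 x (het hx)]

end Solve

/-! ### From finite sets to the whole index set -/

section Extend

variable {R : Type u} [Ring R] {X : Type u} {a : X → X →₀ R}
  {J : Type u} [AddCommGroup J] [Module Rᵐᵒᵖ J]

/-- A cycle is lifted first modulo `S`, by `hlift`; the remaining error is a cycle supported in `S`
and is lifted there. -/
lemma IsExactSubset.union_iUnion (ha : ∀ x, Finsupp.linearCombination R a (a x) = 0)
    {S : Set X} (hS : IsExactSubset a J S) {s : ℕ → Finset X} (hs : Monotone s)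
    (hsupp : ∀ n, ∀ x ∈ s n, ∀ y, a x y ≠ 0 → y ∈ s (n + 1))
    (hlift : ∀ n, ∀ j : X →₀ J, j.support ⊆ s n → (∀ y ∉ S, rightMap a J j y = 0) →
      ∃ e : X →₀ J, e.support ⊆ s (n + 1) ∧ ∀ x ∉ S, rightMap a J e x = j x) :
    IsExactSubset a J (S ∪ ⋃ n, (s n : Set X)) where
  mem_of_mem := by
    rintro x (hx | hx) y hy
    · exact Or.inl (hS.mem_of_mem x hx y hy)
    · obtain ⟨n, hn⟩ := Set.mem_iUnion.1 hx
      exact Or.inr (Set.mem_iUnion.2 ⟨n + 1, hsupp n x hn y hy⟩)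
  exists_lift u hu := by
    classical
    obtain ⟨n, hn⟩ : ∃ n, u.filter (· ∉ S) ⊆ s n := by
      have hd : Directed (· ⊆ ·) fun n => (s n : Set X) :=
        Monotone.directed_le fun m n hmn => Finset.coe_subset.2 (hs hmn)
      obtain ⟨n, hn⟩ := hd.exists_mem_subset_of_finset_subset_biUnion
        (s := u.filter (· ∉ S)) fun x hx => by
          have hx' := Finset.mem_filter.1 hx
          exact (hu hx'.1).resolve_left hx'.2
      exact ⟨n, Finset.coe_subset.1 hn⟩
    obtain ⟨t, htS, ht⟩ := hS.exists_lift
      ((u ∪ (s (n + 1)).biUnion fun x => (a x).support).filter (· ∈ S))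
      (fun x hx => (Finset.mem_filter.1 hx).2)
    refine ⟨s (n + 1) ∪ t, ?_, fun j hj hj0 => ?_⟩
    · rw [Finset.coe_union]
      exact Set.union_subset (fun x hx => Or.inr (Set.mem_iUnion.2 ⟨n + 1, hx⟩))
        (htS.trans Set.subset_union_left)
    obtain ⟨e, he, hej⟩ := hlift n (j.filter (· ∉ S))
      ((Finsupp.support_filter (· ∉ S) j).trans_subset
        ((Finset.filter_subset_filter _ hj).trans hn)) fun y hy => by
        have h1 : rightMap a J (j.filter (· ∈ S)) y = 0 :=
          hS.rightMap_apply_eq_zero (fun x hx => Finsupp.filter_apply_neg _ _ hx) hy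
        have h2 : rightMap a J (j.filter (· ∈ S)) y + rightMap a J (j.filter (· ∉ S)) y = 0 := by
          rw [← Finsupp.add_apply, ← map_add, Finsupp.filter_add_filter_not, hj0,
            Finsupp.zero_apply]
        rwa [h1, zero_add] at h2
    obtain ⟨g, hg, hgj⟩ := ht (j - rightMap a J e) (fun x hx => by
      have hx' := Finsupp.mem_support_iff.1 hx
      refine Finset.mem_filter.2 ⟨?_, ?_⟩
      · rw [Finset.mem_union]
        by_contra! hc
        refine hx' ?_
        rw [Finsupp.sub_apply, Finsupp.notMem_support_iff.1 fun h => hc.1 (hj h), zero_sub,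
          neg_eq_zero]
        by_contra hne
        obtain ⟨z, hz, hzx⟩ := exists_of_rightMap_apply_ne_zero hne
        exact hc.2 (Finset.mem_biUnion.2 ⟨z, he hz, Finsupp.mem_support_iff.2 hzx⟩)
      · by_contra hxS
        refine hx' ?_
        rw [Finsupp.sub_apply, hej x hxS, Finsupp.filter_apply_pos (· ∉ S) j hxS, sub_self])
      (by rw [map_sub, rightMap_rightMap a ha, hj0, sub_zero])
    refine ⟨e + g, Finsupp.support_add.trans (Finset.union_subset_union he hg), ?_⟩
    rw [map_add, hgj]
    abel

lemma linearCombination_linearCombination_eq_zero {P : Type u} [AddCommGroup P] [Module R P]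
    (ha : ∀ x, Finsupp.linearCombination R a (a x) = 0) (k : X → P) (x : X) :
    Finsupp.linearCombination R (fun y => Finsupp.linearCombination R k (a y)) (a x) = 0 := by
  have h1 : ∀ f : X →₀ R, Finsupp.linearCombination R
      (fun y => Finsupp.linearCombination R k (a y)) f =
        Finsupp.linearCombination R k (Finsupp.linearCombination R a f) := fun f => by
    induction f using Finsupp.induction_linear with
    | zero => simp
    | add f₁ f₂ h₁ h₂ => simp only [map_add, h₁, h₂]
    | single y r => simp
  rw [h1, ha, map_zero]

lemma linearCombination_sub_fun {P : Type u} [AddCommGroup P] [Module R P] (k l : X → P)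
    (f : X →₀ R) : Finsupp.linearCombination R (fun x => k x - l x) f =
      Finsupp.linearCombination R k f - Finsupp.linearCombination R l f := by
  simp [Finsupp.linearCombination_apply, smul_sub, Finsupp.sum_sub]

lemma linearCombination_congr_fun {P : Type u} [AddCommGroup P] [Module R P] {k l : X → P}
    {f : X →₀ R} (h : ∀ x, f x ≠ 0 → k x = l x) :
    Finsupp.linearCombination R k f = Finsupp.linearCombination R l f :=
  Finset.sum_congr rfl fun x hx => by
    simp [h x (Finsupp.mem_support_iff.1 hx)]

variable {P : Type u} [AddCommGroup P] [Module R P]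

/-- Successive approximations to a solution on the finite sets `s n` can be made to stabilize,
because the corrections are themselves coboundaries. -/
lemma exists_solution_on_iUnion (ha : ∀ x, Finsupp.linearCombination R a (a x) = 0)
    {S : Set X} (hS : ∀ x ∈ S, ∀ y, a x y ≠ 0 → y ∈ S) {s : ℕ → Finset X} (hs : Monotone s)
    (hsupp : ∀ n, ∀ x ∈ s n, ∀ y, a x y ≠ 0 → y ∈ s (n + 1))
    (hsol : ∀ n, ∀ h : X → P, (∀ x ∈ S, h x = 0) →
      (∀ x ∈ s (n + 1), Finsupp.linearCombination R h (a x) = 0) →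
      ∃ k : X → P, (∀ x ∈ S, k x = 0) ∧ ∀ x ∈ s n, Finsupp.linearCombination R k (a x) = h x)
    (h : X → P) (hhS : ∀ x ∈ S, h x = 0)
    (hh : ∀ x, Finsupp.linearCombination R h (a x) = 0) :
    ∃ k : X → P, (∀ x ∈ S, k x = 0) ∧
      ∀ n, ∀ x ∈ s n, Finsupp.linearCombination R k (a x) = h x := by
  classical
  -- The `n`-th approximation solves on `s (n + 1)`, one stage further than the set on which its
  -- values are frozen, because `hsol` loses one stage.
  let A : ℕ → (X → P) → Prop := fun n k => (∀ x ∈ S, k x = 0) ∧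
    ∀ x ∈ s (n + 1), Finsupp.linearCombination R k (a x) = h x
  have hstep : ∀ n k, A n k → ∃ k', A (n + 1) k' ∧ ∀ x ∈ s n, k' x = k x := by
    -- A fresh solution `k₁` on a larger set differs from `k` by a cocycle on `s (n + 1)`, hence on
    -- `s n` by the coboundary of some `l`. Subtracting that coboundary everywhere keeps the
    -- equation, as `a` squares to zero.
    rintro n k ⟨hkS, hk⟩
    obtain ⟨k₁, hk₁S, hk₁⟩ := hsol (n + 2) h hhS fun x _ => hh x
    obtain ⟨l, hlS, hl⟩ := hsol n (fun x => k₁ x - k x)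
      (fun x hx => by rw [hk₁S x hx, hkS x hx, sub_zero]) fun x hx => by
        rw [linearCombination_sub_fun, hk₁ x (hs (Nat.le_succ _) hx), hk x hx, sub_self]
    refine ⟨fun x => k₁ x - Finsupp.linearCombination R l (a x), ⟨fun x hx => ?_, fun x hx => ?_⟩,
      fun x hx => ?_⟩
    · dsimp only
      rw [hk₁S x hx, zero_sub, neg_eq_zero]
      exact Finset.sum_eq_zero fun y hy => by
        simp [hlS y (hS x hx y (Finsupp.mem_support_iff.1 hy))]
    · rw [linearCombination_sub_fun, linearCombination_linearCombination_eq_zero ha, sub_zero,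
        hk₁ x hx]
    · dsimp only
      rw [hl x hx, sub_sub_cancel]
  obtain ⟨k₀, hk₀S, hk₀⟩ := hsol 1 h hhS fun x _ => hh x
  choose! f hfA hf using hstep
  let κ : ℕ → X → P := fun n => Nat.rec k₀ f n
  have hκA : ∀ n, A n (κ n) := fun n => by
    induction n with
    | zero => exact ⟨hk₀S, hk₀⟩
    | succ n ih => exact hfA n _ ih
  have hκ : ∀ n m, n ≤ m → ∀ x ∈ s n, κ m x = κ n x := fun n m hnm => by
    induction m, hnm using Nat.le_induction with
    | base => exact fun _ _ => rfl
    | succ m hnm ih => exact fun x hx => (hf m _ (hκA m) x (hs hnm hx)).trans (ih x hx)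
  refine ⟨fun x => if hx : ∃ n, x ∈ s n then κ (Nat.find hx) x else 0, fun x hx => ?_,
    fun n x hx => ?_⟩
  · dsimp only
    split_ifs with hn
    · exact (hκA _).1 x hx
    · rfl
  · rw [← (hκA (n + 1)).2 x (hs (Nat.le_add_right n 2) hx)]
    refine linearCombination_congr_fun fun y hy => ?_
    have hy' := hsupp n x hx y hy
    have hex : ∃ n, y ∈ s n := ⟨_, hy'⟩
    rw [dif_pos hex]
    exact (hκ _ _ (Nat.find_min' hex hy') y (Nat.find_spec hex)).symm

lemma IsExactSubset.exists_extension (ha : ∀ x, Finsupp.linearCombination R a (a x) = 0)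
    (hX : IsExactSubset a (CharacterModule P) Set.univ) {S : Set X}
    (hS : IsExactSubset a (CharacterModule P) S) (x₀ : X) {h : X → P}
    (hh : ∀ x, Finsupp.linearCombination R h (a x) = 0) {k : X → P}
    (hk : ∀ x ∈ S, Finsupp.linearCombination R k (a x) = h x) :
    ∃ (T : Set X) (l : X → P), S ⊆ T ∧ x₀ ∈ T ∧ IsExactSubset a (CharacterModule P) T ∧
      (∀ x ∈ S, l x = k x) ∧ ∀ x ∈ T, Finsupp.linearCombination R l (a x) = h x := by
  classical
  choose σ hσ using fun s => hS.exists_lift_mod ha hX s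
  -- Close up `{x₀}` both under the supports of rows of `a` and under the finite bounds `σ` for
  -- lifting modulo `S`.
  obtain ⟨s, hs₀, hs_succ⟩ : ∃ s : ℕ → Finset X, x₀ ∈ s 0 ∧
      ∀ n, s (n + 1) = s n ∪ σ (s n) ∪ (s n).biUnion fun x => (a x).support :=
    ⟨fun n => Nat.rec {x₀} (fun _ t => t ∪ σ t ∪ t.biUnion fun x => (a x).support) n,
      Finset.mem_singleton_self x₀, fun _ => rfl⟩
  have hs : Monotone s := monotone_nat_of_le_succ fun n => by
    rw [hs_succ, Finset.union_assoc]
    exact Finset.subset_union_left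
  have hσs : ∀ n, σ (s n) ⊆ s (n + 1) := fun n => by
    rw [hs_succ]
    exact Finset.subset_union_right.trans Finset.subset_union_left
  have hsupp : ∀ n, ∀ x ∈ s n, ∀ y, a x y ≠ 0 → y ∈ s (n + 1) := fun n x hx y hy => by
    rw [hs_succ]
    exact Finset.mem_union_right _ (Finset.mem_biUnion.2 ⟨x, hx, Finsupp.mem_support_iff.2 hy⟩)
  have hlift : ∀ n, ∀ j : X →₀ CharacterModule P, j.support ⊆ s n →
      (∀ y ∉ S, rightMap a _ j y = 0) → ∃ e : X →₀ CharacterModule P,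
        e.support ⊆ s (n + 1) ∧ ∀ x ∉ S, rightMap a _ e x = j x := fun n j hj hj0 => by
    obtain ⟨e, he, he'⟩ := hσ (s n) j hj hj0
    exact ⟨e, he.trans (hσs n), he'⟩
  have hd : ∀ x ∈ S, h x - Finsupp.linearCombination R k (a x) = 0 := fun x hx => by
    rw [hk x hx, sub_self]
  obtain ⟨l, hlS, hl⟩ := exists_solution_on_iUnion ha hS.mem_of_mem hs hsupp
    (fun n => IsExactSubset.exists_solution_on_finset (hlift n))
    (fun x => h x - Finsupp.linearCombination R k (a x)) hd fun x => by
      rw [linearCombination_sub_fun, hh, linearCombination_linearCombination_eq_zero ha, sub_zero]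
  have hlin : ∀ x, Finsupp.linearCombination R (fun y => k y - -l y) (a x) =
      Finsupp.linearCombination R k (a x) + Finsupp.linearCombination R l (a x) := fun x => by
    simp [Finsupp.linearCombination_apply, Finsupp.sum_add]
  have hx₀ : x₀ ∈ S ∪ ⋃ n, (s n : Set X) :=
    Or.inr (Set.mem_iUnion.2 ⟨0, hs₀⟩)
  refine ⟨S ∪ ⋃ n, (s n : Set X), fun y => k y - -l y, Set.subset_union_left, hx₀,
    hS.union_iUnion ha hs hsupp hlift,
    fun x hx => by simp [hlS x hx], ?_⟩
  rintro x (hx | hx)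
  · rw [hlin, hk x hx, add_eq_left]
    exact Finset.sum_eq_zero fun y hy => by
      simp [hlS y (hS.mem_of_mem x hx y (Finsupp.mem_support_iff.1 hy))]
  · obtain ⟨n, hn⟩ := Set.mem_iUnion.1 hx
    rw [hlin, hl n x hn, add_sub_cancel]

theorem IsExactSubset.exists_solution (ha : ∀ x, Finsupp.linearCombination R a (a x) = 0)
    (hX : IsExactSubset a (CharacterModule P) Set.univ) (h : X → P)
    (hh : ∀ x, Finsupp.linearCombination R h (a x) = 0) :
    ∃ k : X → P, ∀ x, Finsupp.linearCombination R k (a x) = h x := by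
  classical
  -- Zorn's lemma on partial solutions. Values outside the subset `p.1` are junk: its closure under
  -- `a` keeps them out of the equations.
  let Q := {p : Set X × (X → P) // IsExactSubset a (CharacterModule P) p.1 ∧
    ∀ x ∈ p.1, Finsupp.linearCombination R p.2 (a x) = h x}
  let r : Q → Q → Prop := fun p q => p.1.1 ⊆ q.1.1 ∧ ∀ x ∈ p.1.1, q.1.2 x = p.1.2 x
  have hr : ∀ {p q w}, r p q → r q w → r p w := fun {p q w} h₁ h₂ =>
    ⟨h₁.1.trans h₂.1, fun x hx => (h₂.2 x (h₁.1 hx)).trans (h₁.2 x hx)⟩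
  let p₀ : Q := ⟨(∅, 0), isExactSubset_empty, by simp⟩
  have : Nonempty Q := ⟨p₀⟩
  obtain ⟨p, hp⟩ := exists_maximal_of_chains_bounded (r := r) (fun c hc => by
    obtain rfl | hne := c.eq_empty_or_nonempty
    · exact ⟨p₀, by simp⟩
    have hcmp : ∀ p ∈ c, ∀ q ∈ c, r p q ∨ r q p := fun p hp q hq => by
      obtain rfl | hpq := eq_or_ne p q
      · exact Or.inl ⟨subset_rfl, fun _ _ => rfl⟩
      · exact hc hp hq hpq
    let U : Set X := ⋃₀ ((fun p : Q => p.1.1) '' c)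
    have hU : ∀ x : X, x ∈ U → ∃ p ∈ c, x ∈ p.1.1 := by
      rintro x ⟨_, ⟨p, hp, rfl⟩, hx⟩
      exact ⟨p, hp, hx⟩
    choose! φ hφc hφ using hU
    let k : X → P := fun x => (φ x).1.2 x
    have hUc : ∀ p ∈ c, p.1.1 ⊆ U := fun p hp => Set.subset_sUnion_of_mem ⟨p, hp, rfl⟩
    have hk : ∀ p ∈ c, ∀ x ∈ p.1.1, k x = p.1.2 x := fun p hp x hx => by
      have hxU := hUc p hp hx
      obtain h' | h' := hcmp p hp (φ x) (hφc x hxU)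
      · exact h'.2 x hx
      · exact (h'.2 x (hφ x hxU)).symm
    refine ⟨⟨(U, k), isExactSubset_sUnion ?_ (hne.image _) ?_, ?_⟩,
      fun p hp => ⟨hUc p hp, hk p hp⟩⟩
    · rintro _ ⟨p, hp, rfl⟩ _ ⟨q, hq, rfl⟩
      obtain h' | h' := hcmp p hp q hq
      · exact ⟨_, ⟨q, hq, rfl⟩, h'.1, subset_rfl⟩
      · exact ⟨_, ⟨p, hp, rfl⟩, subset_rfl, h'.1⟩
    · rintro _ ⟨p, hp, rfl⟩
      exact p.2.1
    · intro x hx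
      have hx' := hφ x hx
      rw [← (φ x).2.2 x hx']
      exact linearCombination_congr_fun fun y hy =>
        hk _ (hφc x hx) y ((φ x).2.1.mem_of_mem x hx' y hy)) hr
  refine ⟨p.1.2, fun x => p.2.2 x ?_⟩
  obtain ⟨T, l, hST, hxT, hT, hlk, hl⟩ := 
    IsExactSubset.exists_extension ha hX p.2.1 x hh p.2.2
  exact (hp ⟨(T, l), hT, hl⟩ ⟨hST, hlk⟩).1 hxT

end Extend

/-! ### Reduction of acyclic complexes to one periodic extension -/

section Periodic

variable {R : Type u} [Ring R]

/-- In the basis `b`, the endomorphism `f ∘ p` of `F` is a square-zero exact matrix `a`, and `g ∘ p`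
is a cocycle for it. A solution `k` defines `g'` with `g' ∘ f ∘ p = g ∘ p`, and `p` is surjective.
-/
lemma exists_extension_of_periodic {m : ℕ}
    (hm : ∀ I : ModuleCat.{u} Rᵐᵒᵖ, Module.Injective Rᵐᵒᵖ I → HasProjectiveDimensionLT I (m + 1))
    {X S F P : Type u} [AddCommGroup S] [Module R S] [AddCommGroup F] [Module R F]
    [AddCommGroup P] [Module R P] [Module.Projective R P] (b : Module.Basis X R F)
    (f : S →ₗ[R] F) (p : F →ₗ[R] S) (hf : Function.Injective f) (hfp : Function.Exact f p)
    (hp : Function.Surjective p) (g : S →ₗ[R] P) : ∃ g' : F →ₗ[R] P, ∀ s, g' (f s) = g s := by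
  let a : X → X →₀ R := fun x => b.repr (f (p (b x)))
  have hcomb : ∀ {N : Type u} [AddCommGroup N] [Module R N] (φ : F →ₗ[R] N) (z : X →₀ R),
      Finsupp.linearCombination R (fun x => φ (b x)) z = φ (b.repr.symm z) := fun φ z => by
    rw [b.repr_symm_apply, Finsupp.apply_linearCombination]
    rfl
  have hac : ∀ z, Finsupp.linearCombination R a z = b.repr (f (p (b.repr.symm z))) :=
    hcomb (b.repr.toLinearMap ∘ₗ f ∘ₗ p)
  have hpf : ∀ s, p (f s) = 0 := hfp.apply_apply_eq_zero
  have ha : ∀ x, Finsupp.linearCombination R a (a x) = 0 := fun x => by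
    rw [hac]
    simp [a, hpf]
  have hex : ∀ z : X →₀ R, Finsupp.linearCombination R a z = 0 →
      ∃ w, Finsupp.linearCombination R a w = z := fun z hz => by
    rw [hac, LinearEquiv.map_eq_zero_iff, map_eq_zero_iff f hf] at hz
    obtain ⟨s, hs⟩ := (hfp _).1 hz
    obtain ⟨w, rfl⟩ := hp s
    exact ⟨b.repr w, by rw [hac, LinearEquiv.symm_apply_apply, hs, LinearEquiv.apply_symm_apply]⟩
  have hX : IsExactSubset a (CharacterModule P) Set.univ := isExactSubset_univ fun L => by
    have := hm (ModuleCat.of Rᵐᵒᵖ (L → CharacterModule P))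
      (inferInstanceAs (Module.Injective Rᵐᵒᵖ (L → CharacterModule P)))
    exact TensorExact.of_hasProjectiveDimensionLT ha (tensorExact_self hex) m
      (ModuleCat.of Rᵐᵒᵖ (L → CharacterModule P))
  obtain ⟨k, hk⟩ := IsExactSubset.exists_solution ha hX (fun x => g (p (b x))) fun x => by
    refine (hcomb (g ∘ₗ p) (a x)).trans ?_
    simp [a, hpf]
  refine ⟨b.constr ℕ k, fun s => ?_⟩
  obtain ⟨z, rfl⟩ := hp s
  have h : (b.constr ℕ k ∘ₗ f) ∘ₗ p = g ∘ₗ p := b.ext fun x => by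
    simpa [Module.Basis.constr_apply, Finsupp.linearCombination_apply, a] using hk x
  exact LinearMap.congr_fun h z

/-- There is a short exact sequence `0 → A → F → B → 0` with `F` free. -/
def ModuleCat.FreeExtension (A B : ModuleCat.{u} R) : Prop :=
  ∃ (X : Type u) (f : A →ₗ[R] X →₀ R) (p : (X →₀ R) →ₗ[R] B),
    Function.Injective f ∧ Function.Exact f p ∧ Function.Surjective p

open DirectSum in
lemma exists_extension_of_freeExtension {m : ℕ}
    (hm : ∀ I : ModuleCat.{u} Rᵐᵒᵖ, Module.Injective Rᵐᵒᵖ I → HasProjectiveDimensionLT I (m + 1))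
    (S : ℤ → ModuleCat.{u} R) (hS : ∀ i, ModuleCat.FreeExtension (S i) (S (i + 1)))
    {P : Type u} [AddCommGroup P] [Module R P] [Module.Projective R P] (i : ℤ) :
    ∃ (X : Type u) (f : S i →ₗ[R] X →₀ R) (p : (X →₀ R) →ₗ[R] S (i + 1)),
      Function.Injective f ∧ Function.Exact f p ∧ Function.Surjective p ∧
      ∀ g : S i →ₗ[R] P, ∃ g' : (X →₀ R) →ₗ[R] P, ∀ s, g' (f s) = g s := by
  choose X f p hf hfp hp using hS
  -- Reindexing by the shift identifies the two ends of the summed sequence, which makes it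
  -- periodic.
  let e : (⨁ i, S i) ≃ₗ[R] ⨁ i, S (i + 1) :=
    DirectSum.lequivCongrLeft R (M := fun i => S i) (Equiv.addRight (1 : ℤ)).symm
  let b : Module.Basis (Σ i, X i) R (⨁ i, (X i →₀ R)) :=
    DFinsupp.basis fun i => Finsupp.basisSingleOne
  let π : (⨁ i, (X i →₀ R)) →ₗ[R] ⨁ i, S i :=
    e.symm.toLinearMap ∘ₗ DirectSum.lmap (R := R) p
  have hexact : Function.Exact (DirectSum.lmap f) π := by
    rw [LinearMap.exact_iff, LinearEquiv.ker_comp]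
    ext z
    rw [DirectSum.ker_lmap, DirectSum.range_lmap]
    simp only [fun i => LinearMap.exact_iff.1 (hfp i)]
  have hsurj : Function.Surjective π :=
    e.symm.surjective.comp ((DirectSum.lmap_surjective p).2 hp)
  refine ⟨X i, f i, p i, hf i, hfp i, hp i, fun g => ?_⟩
  obtain ⟨G, hG⟩ := exists_extension_of_periodic (S := ⨁ i, S i) (F := ⨁ i, (X i →₀ R))
    hm b (DirectSum.lmap f)
    π (DirectSum.lmap_injective f |>.2 hf) hexact hsurj
    (g ∘ₗ DirectSum.component R ℤ (fun i => S i) i)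
  refine ⟨G ∘ₗ DirectSum.lof R ℤ (fun i => X i →₀ R) i, fun s => ?_⟩
  have h := hG (DirectSum.lof R ℤ (fun i => S i) i s)
  rw [DirectSum.lmap_lof] at h
  rw [LinearMap.comp_apply, h, LinearMap.comp_apply, DirectSum.component.lof_self]

end Periodic

/-! ### Syzygies, acyclic complexes of free modules and dimension shifting -/

section Syzygy

variable {R : Type u} [Ring R]

namespace ModuleCat

/-- The kernel of the canonical free cover of a module. -/
noncomputable def syzygy (M : ModuleCat.{u} R) : ModuleCat.{u} R :=
  ModuleCat.of R (LinearMap.ker (Finsupp.linearCombination R (id : M → M)))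

lemma freeExtension_syzygy (M : ModuleCat.{u} R) : FreeExtension (syzygy M) M :=
  ⟨M, (LinearMap.ker (Finsupp.linearCombination R (id : M → M))).subtype,
    Finsupp.linearCombination R id, Submodule.injective_subtype _,
    LinearMap.exact_subtype_ker_map _, Finsupp.linearCombination_id_surjective R M⟩

/-- The horseshoe lemma for kernels of free covers. -/
lemma exists_exact_syzygy {A B C : ModuleCat.{u} R} (f : A →ₗ[R] B) (g : B →ₗ[R] C)
    (hf : Function.Injective f) (hfg : Function.Exact f g) (hg : Function.Surjective g) :
    ∃ (F : ModuleCat.{u} R) (_ : Module.Projective R F) (θ : F →ₗ[R] B)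
      (f' : syzygy A →ₗ[R] LinearMap.ker θ) (g' : LinearMap.ker θ →ₗ[R] syzygy C),
      Function.Surjective θ ∧ Function.Injective f' ∧ Function.Exact f' g' ∧
      Function.Surjective g' := by
  let εA : (A →₀ R) →ₗ[R] A := Finsupp.linearCombination R id
  let εC : (C →₀ R) →ₗ[R] C := Finsupp.linearCombination R id
  obtain ⟨σ, hσ⟩ := hg.hasRightInverse
  let s : (C →₀ R) →ₗ[R] B := Finsupp.linearCombination R σ
  have hs : ∀ q, g (s q) = εC q := fun q => by
    simp only [s, εC, Finsupp.apply_linearCombination]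
    congr 2
    ext c
    exact hσ c
  have hgf : ∀ x, g (f x) = 0 := hfg.apply_apply_eq_zero
  let θ : ((A →₀ R) × (C →₀ R)) →ₗ[R] B := (f ∘ₗ εA).coprod s
  have hθ : ∀ z, θ z = f (εA z.1) + s z.2 := fun z => by simp [θ, LinearMap.coprod_apply]
  have hεA : Function.Surjective εA := Finsupp.linearCombination_id_surjective R A
  have hεC : Function.Surjective εC := Finsupp.linearCombination_id_surjective R C
  have hker : ∀ y, g y = 0 → ∃ q, f (εA q) = y := fun y hy => by
    obtain ⟨x, rfl⟩ := (hfg y).1 hy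
    obtain ⟨q, rfl⟩ := hεA x
    exact ⟨q, rfl⟩
  let f' : LinearMap.ker εA →ₗ[R] LinearMap.ker θ :=
    LinearMap.codRestrict _ (LinearMap.inl R _ _ ∘ₗ (LinearMap.ker εA).subtype) fun x => by
      have hx : εA x = 0 := x.2
      simp [hθ, hx]
  let g' : LinearMap.ker θ →ₗ[R] LinearMap.ker εC :=
    LinearMap.codRestrict _ (LinearMap.snd R _ _ ∘ₗ (LinearMap.ker θ).subtype) fun z => by
      have hz : θ z = 0 := z.2
      have := congrArg g hz
      rw [hθ, map_add, hgf, zero_add, hs, map_zero] at this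
      exact this
  refine ⟨ModuleCat.of R ((A →₀ R) × (C →₀ R)),
    inferInstanceAs (Module.Projective R ((A →₀ R) × (C →₀ R))), θ, f', g', ?_, ?_, ?_, ?_⟩
  · intro y
    obtain ⟨q, hq⟩ := hεC (g y)
    obtain ⟨q', hq'⟩ := hker (y - s q) (by rw [map_sub, hs, hq, sub_self])
    exact ⟨(q', q), by rw [hθ, hq', sub_add_cancel]⟩
  · intro x y hxy
    have h1 := congrArg (fun z : LinearMap.ker θ => z.1.1) hxy
    exact Subtype.ext h1
  · intro z
    constructor
    · intro hz
      have h2 : z.1.2 = 0 := congrArg Subtype.val hz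
      have h3 : θ z.1 = 0 := z.2
      rw [hθ, h2, map_zero, add_zero, map_eq_zero_iff f hf] at h3
      exact ⟨⟨z.1.1, h3⟩, Subtype.ext (Prod.ext rfl h2.symm)⟩
    · rintro ⟨x, rfl⟩
      exact Subtype.ext rfl
  · rintro ⟨q, hq⟩
    obtain ⟨q', hq'⟩ := hker (-s q) (by rw [map_neg, hs, LinearMap.mem_ker.1 hq, neg_zero])
    exact ⟨⟨(q', q), by rw [LinearMap.mem_ker, hθ, hq', neg_add_cancel]⟩, Subtype.ext rfl⟩

/-- Each use of the horseshoe lemma replaces the middle term by a kernel of projective dimension one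
less, until it is projective. -/
lemma exists_projective_exact_syzygy (n : ℕ) {A B C : ModuleCat.{u} R}
    [HasProjectiveDimensionLT B (n + 1)] (f : A →ₗ[R] B) (g : B →ₗ[R] C)
    (hf : Function.Injective f) (hfg : Function.Exact f g) (hg : Function.Surjective g) :
    ∃ (Q : ModuleCat.{u} R) (_ : Module.Projective R Q) (f' : syzygy^[n] A →ₗ[R] Q)
      (g' : Q →ₗ[R] syzygy^[n] C),
      Function.Injective f' ∧ Function.Exact f' g' ∧ Function.Surjective g' := by
  induction n generalizing A B C with
  | zero =>
    refine ⟨B, ?_, f, g, hf, hfg, hg⟩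
    rw [IsProjective.iff_projective]
    exact projective_iff_hasProjectiveDimensionLT_one.2 inferInstance
  | succ n ih =>
    obtain ⟨F, hF, θ, f', g', hθ, hf', hfg', hg'⟩ := exists_exact_syzygy f g hf hfg hg
    have hS := LinearMap.shortExact_shortComplexKer hθ
    have : Projective (ModuleCat.of R F) := ModuleCat.projective_of_categoryTheory_projective _
    have hK := (hS.hasProjectiveDimensionLT_X₃_iff n this).1 ‹_›
    exact ih (B := ModuleCat.of R (LinearMap.ker θ)) f' g' hf' hfg' hg'

/-- A module is a stable `n`-th syzygy if it is the sum of an `n`-th syzygy and a projective. -/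
def IsStableSyzygy (n : ℕ) (S : ModuleCat.{u} R) : Prop :=
  ∃ (M Q : ModuleCat.{u} R) (_ : Module.Projective R Q),
    Nonempty (S ≃ₗ[R] ((syzygy^[n] M : ModuleCat.{u} R) × Q))

lemma IsStableSyzygy.exists_freeExtension {n : ℕ}
    (hn : ∀ I : ModuleCat.{u} R, Module.Injective R I → HasProjectiveDimensionLT I (n + 1))
    {S : ModuleCat.{u} R} (hS : IsStableSyzygy n S) :
    ∃ T : ModuleCat.{u} R, IsStableSyzygy n T ∧ FreeExtension S T := by
  obtain ⟨M, Q', hQ', ⟨e⟩⟩ := hS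
  obtain ⟨I, hI, i, hi⟩ := EnoughInjectives.presentation M
  have hinj : Function.Injective i.hom := (mono_iff_injective i).1 hi
  have := hn I (Module.injective_module_of_injective_object R I)
  obtain ⟨Q, hQ, f, g, hf, hfg, hg⟩ := exists_projective_exact_syzygy n
    (C := ModuleCat.of R (I ⧸ LinearMap.range i.hom)) i.hom (Submodule.mkQ _) hinj
    i.hom.exact_map_mkQ_range (Submodule.mkQ_surjective _)
  -- The middle term `K` is only projective. Adding the kernel of its free cover to the middle and
  -- to the cokernel makes the middle free; this is why a projective summand is allowed in
  -- `IsStableSyzygy`.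
  let K := Q × Q'
  let ε : (K →₀ R) →ₗ[R] K := Finsupp.linearCombination R id
  obtain ⟨s, hs⟩ := Module.projective_def'.1 (inferInstance : Module.Projective R K)
  have hεs : ∀ x, ε (s x) = x := LinearMap.congr_fun hs
  let ρ : (K →₀ R) →ₗ[R] LinearMap.ker ε :=
    LinearMap.codRestrict _ (LinearMap.id - s ∘ₗ ε) fun z => by simp [hεs]
  have hρ : ∀ z, (ρ z : K →₀ R) = z - s (ε z) := fun z => rfl
  have hker : Module.Projective R (LinearMap.ker ε) :=
    Module.Projective.of_split (LinearMap.ker ε).subtype ρ <| LinearMap.ext fun z =>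
      Subtype.ext (by
        have hz : ε z = 0 := z.2
        simp [hρ, hz])
  refine ⟨ModuleCat.of R ((syzygy^[n] (ModuleCat.of R (I ⧸ LinearMap.range i.hom)) :
      ModuleCat.{u} R) × LinearMap.ker ε),
    ⟨_, ModuleCat.of R (LinearMap.ker ε), hker, ⟨LinearEquiv.refl R _⟩⟩, K,
    s ∘ₗ f.prodMap LinearMap.id ∘ₗ e.toLinearMap,
    (g ∘ₗ LinearMap.fst R Q Q' ∘ₗ ε).prod ρ, ?_, ?_, ?_⟩
  · have hsinj : Function.Injective s := Function.LeftInverse.injective hεs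
    intro x y hxy
    have h1 := hsinj hxy
    have h2 : (f (e x).1, (e x).2) = (f (e y).1, (e y).2) := h1
    rw [Prod.mk.injEq] at h2
    exact e.injective (Prod.ext (hf h2.1) h2.2)
  · intro z
    constructor
    · intro hz
      have h1 : g (ε z).1 = 0 := congrArg Prod.fst hz
      have h2 : ρ z = 0 := congrArg Prod.snd hz
      have h3 : z = s (ε z) := sub_eq_zero.1 (congrArg Subtype.val h2)
      obtain ⟨x, hx⟩ := (hfg _).1 h1
      refine ⟨e.symm (x, (ε z).2), ?_⟩
      have h4 : (f x, (ε z).2) = ε z := Prod.ext hx rfl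
      change s (f.prodMap LinearMap.id (e (e.symm (x, (ε z).2)))) = z
      rw [e.apply_symm_apply]
      exact (congrArg s h4).trans h3.symm
    · rintro ⟨x, rfl⟩
      refine Prod.ext ?_ (Subtype.ext ?_)
      · change g (ε (s (f (e x).1, (e x).2))).1 = 0
        rw [hεs]
        exact hfg.apply_apply_eq_zero _
      · change s (f (e x).1, (e x).2) - s (ε (s (f (e x).1, (e x).2))) = 0
        rw [hεs, sub_self]
  · rintro ⟨c, w⟩
    obtain ⟨q, rfl⟩ := hg c
    have hw : ε w = 0 := w.2
    refine ⟨s (q, 0) + w, Prod.ext ?_ (Subtype.ext ?_)⟩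
    · change g (ε (s (q, 0) + w)).1 = g q
      rw [map_add, hεs, hw, add_zero]
    · change s (q, 0) + w - s (ε (s (q, 0) + w)) = w
      rw [map_add, hεs, hw, add_zero, add_sub_cancel_left]

lemma IsStableSyzygy.exists_complex {n : ℕ}
    (hn : ∀ I : ModuleCat.{u} R, Module.Injective R I → HasProjectiveDimensionLT I (n + 1))
    {Z : ModuleCat.{u} R} (hZ : IsStableSyzygy n Z) :
    ∃ S : ℤ → ModuleCat.{u} R, S 0 = Z ∧ ∀ i, FreeExtension (S i) (S (i + 1)) := by
  choose T hT hTS using fun S : {S : ModuleCat.{u} R // IsStableSyzygy n S} =>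
    S.2.exists_freeExtension hn
  let U : ℕ → {S : ModuleCat.{u} R // IsStableSyzygy n S} := fun k =>
    Nat.rec ⟨Z, hZ⟩ (fun _ S => ⟨T S, hT S⟩) k
  -- Nonnegative degrees use the embeddings into free modules; negative degrees use the ordinary
  -- free resolution of `Z`.
  let S : ℤ → ModuleCat.{u} R := fun i => Int.rec (fun k => (U k).1) (fun j => syzygy^[j + 1] Z) i
  refine ⟨S, rfl, fun i => ?_⟩
  obtain k | j := i
  · exact hTS (U k)
  · have h : S (Int.negSucc j + 1) = syzygy^[j] Z := by
      obtain _ | j := j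
      · rfl
      · rw [show Int.negSucc (j + 1) + 1 = Int.negSucc j by lia]
    rw [h]
    change FreeExtension (syzygy^[j + 1] Z) _
    rw [Function.iterate_succ_apply']
    exact freeExtension_syzygy _

lemma isStableSyzygy_iterate (n : ℕ) (M : ModuleCat.{u} R) : IsStableSyzygy n (syzygy^[n] M) :=
  ⟨M, ModuleCat.of R PUnit.{u + 1}, inferInstanceAs (Module.Projective R PUnit.{u + 1}),
    ⟨LinearEquiv.symm (LinearEquiv.prodUnique (R := R) (M₂ := PUnit.{u + 1}))⟩⟩

open Abelian in
lemma subsingleton_ext_one_of_extension {A B P : ModuleCat.{u} R} {X : Type u}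
    (f : A →ₗ[R] X →₀ R) (p : (X →₀ R) →ₗ[R] B) (hf : Function.Injective f)
    (hfp : Function.Exact f p) (hp : Function.Surjective p)
    (hext : ∀ g : A →ₗ[R] P, ∃ g' : (X →₀ R) →ₗ[R] P, ∀ s, g' (f s) = g s) :
    Subsingleton (Ext B P 1) := by
  let T : ShortComplex (ModuleCat.{u} R) :=
    ModuleCat.shortComplexOfCompEqZero f p hfp.linearMap_comp_eq_zero
  have hT : T.ShortExact := ModuleCat.shortComplex_shortExact T hfp hf hp
  have : Projective T.X₂ := ModuleCat.projective_of_categoryTheory_projective (of R (X →₀ R))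
  refine subsingleton_of_forall_eq 0 fun x => ?_
  obtain ⟨y, rfl⟩ := Ext.contravariant_sequence_exact₃ hT P x (Ext.eq_zero_of_projective _)
    (n₀ := 0) rfl
  obtain ⟨y, rfl⟩ := Ext.homEquiv₀.symm.surjective y
  obtain ⟨g', hg'⟩ := hext y.hom
  have h : y = T.f ≫ ModuleCat.ofHom g' := by
    ext s
    exact (hg' s).symm
  rw [Ext.homEquiv₀_symm_apply, h, ← Ext.mk₀_comp_mk₀, ShortComplex.ShortExact.extClass_comp_assoc]

open Abelian in
lemma subsingleton_ext_of_syzygy (n : ℕ) {M P : ModuleCat.{u} R}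
    (h : Subsingleton (Ext (syzygy^[n] M) P 1)) : Subsingleton (Ext M P (n + 1)) := by
  induction n generalizing M with
  | zero => exact h
  | succ n ih =>
    have hS := LinearMap.shortExact_shortComplexKer (Finsupp.linearCombination_id_surjective R M)
    have : Projective (ModuleCat.of R (M →₀ R)) :=
      ModuleCat.projective_of_categoryTheory_projective _
    have hK : Subsingleton (Ext (syzygy M) P (n + 1)) := ih h
    refine subsingleton_of_forall_eq 0 fun x => ?_
    obtain ⟨y, rfl⟩ := Ext.contravariant_sequence_exact₃ hS P x (Ext.eq_zero_of_projective _)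
      (n₀ := n + 1) (by lia)
    rw [show y = 0 from hK.elim _ _, Ext.comp_zero]

theorem hasInjectiveDimensionLT_of_projective {n m : ℕ}
    (hn : ∀ I : ModuleCat.{u} R, Module.Injective R I → HasProjectiveDimensionLT I (n + 1))
    (hm : ∀ I : ModuleCat.{u} Rᵐᵒᵖ, Module.Injective Rᵐᵒᵖ I → HasProjectiveDimensionLT I (m + 1))
    (P : ModuleCat.{u} R) [Module.Projective R P] : HasInjectiveDimensionLT P (n + 1) := by
  refine hasInjectiveDimensionLT_of_enoughProjectives P (n + 1) fun M => ?_
  refine subsingleton_ext_of_syzygy n ?_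
  obtain ⟨S, hS0, hS⟩ := (isStableSyzygy_iterate n M).exists_complex hn
  rw [← hS0]
  obtain ⟨X, f, p, hf, hfp, hp, hext⟩ := exists_extension_of_freeExtension hm S hS (P := P) (-1)
  exact subsingleton_ext_one_of_extension f p hf hfp hp hext

open Abelian in
-- Write `N` as a quotient of a free module with kernel `K`. Then `Ext M N (k + n)` sits between the
-- groups for the free module in degree `k + n` and for `K` in degree `k + n + 1`. The first
-- vanishes by `hk`, the second by the current bound on `M`, so the bound descends to `k`.
theorem hasProjectiveDimensionLT_of_injectiveDimension {k n : ℕ}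
    (hk : ∀ P : ModuleCat.{u} R, Module.Projective R P → HasInjectiveDimensionLT P k)
    (M : ModuleCat.{u} R) (hM : HasProjectiveDimensionLT M (k + n)) :
    HasProjectiveDimensionLT M k := by
  induction n with
  | zero => exact hM
  | succ n ih =>
    refine ih (hasProjectiveDimensionLT_of_enoughInjectives M (k + n) fun N => ?_)
    have hS := LinearMap.shortExact_shortComplexKer (Finsupp.linearCombination_id_surjective R N)
    have hF := hk (ModuleCat.of R (N →₀ R)) (inferInstanceAs (Module.Projective R (N →₀ R)))
    refine subsingleton_of_forall_eq 0 fun x => ?_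
    obtain ⟨y, rfl⟩ := Ext.covariant_sequence_exact₃ M hS x (n₁ := k + n + 1) rfl
      (Ext.eq_zero_of_hasProjectiveDimensionLT _ (k + (n + 1)) (by lia))
    rw [show y = 0 from Ext.eq_zero_of_hasInjectiveDimensionLT y k (by lia), Ext.zero_comp]

end ModuleCat

end Syzygy

/-! ### Comparison of the two invariants -/

section Main

variable (R : Type u) [Ring R]

lemma spli_le_iff (b : WithBot ℕ∞) : spli R ≤ b ↔
    ∀ I : ModuleCat.{u} R, Module.Injective R I → projectiveDimension I ≤ b := by
  simp only [spli, iSup_le_iff]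

lemma silp_le_iff (b : WithBot ℕ∞) : silp R ≤ b ↔
    ∀ P : ModuleCat.{u} R, Module.Projective R P → injectiveDimension P ≤ b := by
  simp only [silp, iSup_le_iff]

lemma WithBot.ENat.exists_nat_of_lt_top {b : WithBot ℕ∞} (h : b < ⊤) : ∃ n : ℕ, b ≤ n := by
  induction b with
  | bot => exact ⟨0, bot_le⟩
  | coe b =>
    induction b with
    | top => exact absurd h (lt_irrefl _)
    | coe n => exact ⟨n, le_rfl⟩

lemma WithBot.ENat.le_of_forall_lt_nat {b c : WithBot ℕ∞} (h : ∀ n : ℕ, c < n → b < n) :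
    b ≤ c := by
  induction c with
  | bot =>
    have h0 : b < ((0 : ℕ) : WithBot ℕ∞) := h 0 (WithBot.bot_lt_coe _)
    rw [Nat.cast_zero, ← WithBot.coe_zero, ← bot_eq_zero', WithBot.lt_coe_bot] at h0
    exact h0.le
  | coe c =>
    induction c with
    | top => exact le_top
    | coe n =>
      have h1 := h (n + 1) (by rw [Nat.cast_add, Nat.cast_one, ENat.WithBot.lt_add_one_iff]; rfl)
      rw [Nat.cast_add, Nat.cast_one, ENat.WithBot.lt_add_one_iff] at h1
      exact h1

/-- Needed to apply `silp_le_spli` to `Rᵐᵒᵖ`, whose hypothesis then concerns the double opposite. -/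
lemma spli_opOp_le : spli Rᵐᵒᵖᵐᵒᵖ ≤ spli R := by
  rw [spli_le_iff]
  intro I hI
  let e : R ≃+* Rᵐᵒᵖᵐᵒᵖ := RingEquiv.opOp R
  let := RingHomInvPair.of_ringEquiv e
  let := RingHomInvPair.symm (e : R →+* Rᵐᵒᵖᵐᵒᵖ) (e.symm : Rᵐᵒᵖᵐᵒᵖ →+* R)
  let I' : ModuleCat.{u} R :=
    letI := Module.compHom I (e : R →+* Rᵐᵒᵖᵐᵒᵖ)
    ModuleCat.of R I
  let eI : I' ≃ₛₗ[RingHomClass.toRingHom e] I :=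
    { AddEquiv.refl I with map_smul' := fun _ _ => rfl }
  have hI' : Module.Injective R I' := Module.Injective.of_ringEquiv e.symm eI.symm
  rw [← ModuleCat.projectiveDimension_eq_of_semiLinearEquiv e eI]
  exact (spli_le_iff R _).1 le_rfl I' hI'

variable {R}

theorem silp_le_spli (hr : spli Rᵐᵒᵖ < ⊤) : silp R ≤ spli R := by
  obtain ⟨m, hm⟩ := WithBot.ENat.exists_nat_of_lt_top hr
  rw [spli_le_iff] at hm
  rw [silp_le_iff]
  intro P hP
  refine WithBot.ENat.le_of_forall_lt_nat fun n hn => ?_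
  have hn' : ∀ I : ModuleCat.{u} R, Module.Injective R I → HasProjectiveDimensionLT I n :=
    fun I hI => projectiveDimension_lt_iff.1 (((spli_le_iff R _).1 le_rfl I hI).trans_lt hn)
  rw [injectiveDimension_lt_iff]
  -- For `n = 0` every injective module is zero, so `P`, which embeds in one, is zero as well.
  obtain _ | n := n
  · obtain ⟨I, hI, i, hi⟩ := EnoughInjectives.presentation P
    have := hn' I (Module.injective_module_of_injective_object R I)
    exact (Limits.IsZero.of_mono i
      (isZero_of_hasProjectiveDimensionLT_zero I)).hasInjectiveDimensionLT_zero
  · exact ModuleCat.hasInjectiveDimensionLT_of_projective hn'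
      (fun I hI => (projectiveDimension_le_iff I m).1 (hm I hI)) P

theorem spli_le_silp (hl : spli R < ⊤) : spli R ≤ silp R := by
  obtain ⟨n, hn⟩ := WithBot.ENat.exists_nat_of_lt_top hl
  rw [spli_le_iff] at hn ⊢
  intro I hI
  refine WithBot.ENat.le_of_forall_lt_nat fun k hk => ?_
  have hk' : ∀ P : ModuleCat.{u} R, Module.Projective R P → HasInjectiveDimensionLT P k :=
    fun P hP => injectiveDimension_lt_iff.1 (((silp_le_iff R _).1 le_rfl P hP).trans_lt hk)
  have := (projectiveDimension_le_iff I n).1 (hn I hI)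
  rw [projectiveDimension_lt_iff]
  exact ModuleCat.hasProjectiveDimensionLT_of_injectiveDimension hk' I
    (hasProjectiveDimensionLT_of_ge I (n + 1) (k + (n + 1)) (by lia))

end Main

/-- Left `Rᵐᵒᵖ`-modules are the right `R`-modules. -/
theorem proposition5p3 (R : Type u) [Ring R] (hl : spli R < ⊤) (hr : spli Rᵐᵒᵖ < ⊤) :
    silp R = spli R ∧ silp Rᵐᵒᵖ = spli Rᵐᵒᵖ :=
  ⟨(silp_le_spli hr).antisymm (spli_le_silp hl),
    (silp_le_spli ((spli_opOp_le R).trans_lt hl)).antisymm (spli_le_silp hr)⟩
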